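/- **Combinatorial bound for regularity.** Let $\Gamma$ be a simplicial complex on a finite vertex set $V$ (every $\{v\}$, $v\in V$, is a face). Let $\Bbbk$ be a field, $S=\Bbbk[x_v \mid v\in V]$ with the standard grading, and let $\mathcal F(\Gamma)\subseteq S$ be the facet ideal of $\Gamma$, generated by the monomials $\prod_{v\in F}x_v$ where $F$ runs over the facets (maximal faces) of $\Gamma$. Let $$\operatorname{reg}(S/\mathcal F(\Gamma))=\max\{\,j-i \mid b_{i,j}(S/\mathcal F(\Gamma))\neq 0\,\},$$ where $b_{i,j}$ is the number of generators of degree $j$ in homological degree $i$ of the minimal graded free resolution of $S/\mathcal F(\Gamma)$. For $A\subseteq V$ the *induced subcollection* $\Gamma_A$ is the simplicial complex whose facets are the facets of $\Gamma$ contained in $A$; its vertices are the elements of these facets. A sequence $F_1,\dots,F_s$ of distinct facets of a complex $\Delta$ is a *well ordered facet cover* of $\Delta$ if every vertex of $\Delta$ lies in some $F_i$, no proper subset of $\{F_1,\dots,F_s\}$ has this property, and for every facet $H\notin\{F_1,\dots,F_s\}$ of $\Delta$ there is $i\le s-1$ with $F_i\subseteq H\cup F_{i+1}\cup\dots\cup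 F_s$. 1. If $F_1,\dots,F_s$ is a well ordered facet cover of some induced subcollection $\Gamma_A$ of $\Gamma$, then $$\operatorname{reg}(S/\mathcal F(\Gamma))\ \ge\ \left|F_1\cup\dots\cup F_s\right|-s .$$ 2. This contains the Morey–Villarreal bound, which is the same inequality for induced matchings: if $F_1,\dots,F_s$ is an induced matching of $\Gamma$ (pairwise disjoint facets that are the only facets of $\Gamma$ contained in $F_1\cup\dots\cup F_s$), listed without repetition in any order, then it is a well ordered facet cover of $\Gamma_A$ for $A=F_1\cup\dots\cup F_s$. -/

import Mathlib

namespace PreAbstractSimplicialComplex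

variable {V : Type*}

/-- The vertices of `Γ`: the points `v` such that `{v}` is a face. -/
def vertices (Γ : PreAbstractSimplicialComplex V) : Set V :=
  {v | {v} ∈ Γ.faces}

/-- The facets of `Γ`: the faces that are maximal with respect to inclusion. -/
def facets (Γ : PreAbstractSimplicialComplex V) : Set (Finset V) :=
  {F | Maximal (fun G => G ∈ Γ.faces) F}

/-- The induced subcollection `Γ_A`: the complex generated by the facets of `Γ` that are contained
in `A`. Its vertices are the points of these facets. -/
def inducedSubcollection (Γ : PreAbstractSimplicialComplex V) (A : Finset V) :
    PreAbstractSimplicialComplex V where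
  faces := {G | G.Nonempty ∧ ∃ F ∈ Γ.facets, F ⊆ A ∧ G ⊆ F}
  isRelLowerSet_faces := by
    rintro G ⟨hG, F, hF, hFA, hGF⟩
    exact ⟨hG, fun H hHG hH => ⟨hH, F, hF, hFA, hHG.trans hGF⟩⟩

/-- A facet cover: a set of facets such that every vertex belongs to one of them. -/
def IsFacetCover (Γ : PreAbstractSimplicialComplex V) (D : Set (Finset V)) : Prop :=
  D ⊆ Γ.facets ∧ ∀ v ∈ Γ.vertices, ∃ F ∈ D, v ∈ F

/-- A minimal facet cover: a facet cover no proper subset of which is a facet cover. -/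
def IsMinimalFacetCover (Γ : PreAbstractSimplicialComplex V) (D : Set (Finset V)) : Prop :=
  Minimal Γ.IsFacetCover D

/-- A well ordered facet cover: a sequence of distinct facets `F 0, …, F (s - 1)` which form a
minimal facet cover, such that for every other facet `H` there is an index `i`, not the last one,
with `F i ⊆ H ∪ F (i + 1) ∪ ⋯ ∪ F (s - 1)`. -/
def IsWellOrderedFacetCover [DecidableEq V] (Γ : PreAbstractSimplicialComplex V) {s : ℕ}
    (F : Fin s → Finset V) : Prop :=
  Function.Injective F ∧ Γ.IsMinimalFacetCover (Set.range F) ∧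
    ∀ H ∈ Γ.facets, H ∉ Set.range F →
      ∃ i : Fin s, (i : ℕ) + 1 < s ∧ F i ⊆ H ∪ (Finset.Ioi i).biUnion F

/-- `F 0, …, F (s - 1)` are the (distinct) members of an induced matching of `Γ`: they are pairwise
disjoint facets and the only facets of `Γ` contained in their union. -/
def IsInducedMatching [DecidableEq V] (Γ : PreAbstractSimplicialComplex V) {s : ℕ}
    (F : Fin s → Finset V) : Prop :=
  (∀ i, F i ∈ Γ.facets) ∧ (∀ i j, i ≠ j → Disjoint (F i) (F j)) ∧
    (Γ.inducedSubcollection (Finset.univ.biUnion F)).facets = Set.range F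

/-- The facet ideal: the ideal of `K[x_v | v ∈ V]` generated by the products of the variables over
the facets of `Γ`. -/
noncomputable def facetIdeal (K : Type*) [Field K] (Γ : PreAbstractSimplicialComplex V) :
    Ideal (MvPolynomial V K) :=
  Ideal.span {m | ∃ F ∈ Γ.facets, m = ∏ v ∈ F, MvPolynomial.X v}

end PreAbstractSimplicialComplex

/-- A minimal graded free resolution
`⋯ → F 2 → F 1 → F 0 → S ⧸ I → 0` of `S ⧸ I` over the standard graded ring `S = K[x_v | v ∈ V]`.
The module `F i` is free on `rank i` homogeneous generators, the `b`-th of which has degree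
`deg i b`; in other words `F i = ⨁ b, S(-deg i b)`. -/
structure MinimalGradedFreeResolution {V K : Type*} [Field K]
    (I : Ideal (MvPolynomial V K)) where
  /-- the number of generators of `F i` -/
  rank : ℕ → ℕ
  /-- the degrees of the generators of `F i` -/
  deg : ∀ i, Fin (rank i) → ℕ
  /-- the differential `F (i + 1) → F i` -/
  d : ∀ i, (Fin (rank (i + 1)) → MvPolynomial V K) →ₗ[MvPolynomial V K]
    (Fin (rank i) → MvPolynomial V K)
  /-- the augmentation `F 0 → S ⧸ I` -/
  aug : (Fin (rank 0) → MvPolynomial V K) →ₗ[MvPolynomial V K] (MvPolynomial V K ⧸ I)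
  aug_surjective : Function.Surjective aug
  exact_aug : Function.Exact (d 0) aug
  exact_d : ∀ i, Function.Exact (d (i + 1)) (d i)
  /-- the augmentation is homogeneous of degree `0` -/
  aug_graded : ∀ b, ∃ f : MvPolynomial V K, f.IsHomogeneous (deg 0 b) ∧
    Ideal.Quotient.mk I f = aug (Pi.single b 1)
  /-- the differentials are homogeneous of degree `0`: the `(c, b)` entry of `d i` is homogeneous
  of degree `deg (i + 1) b - deg i c` (and is zero if this number is negative) -/
  d_graded : ∀ i b c, ∀ u ∈ (d i (Pi.single b 1) c).support,
    u.degree + deg i c = deg (i + 1) b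
  /-- minimality: the image of `d i` lies in `𝔪 F i`, where `𝔪` is generated by the variables -/
  minimal : ∀ i x c, d i x c ∈ Ideal.span (Set.range (MvPolynomial.X : V → MvPolynomial V K))

open Classical in
/-- The graded Betti number `b_{i,j}(S ⧸ I)`: the number of generators of degree `j` in homological
degree `i` of the minimal graded free resolution of `S ⧸ I`. For a homogeneous ideal in finitely
many variables this resolution exists and is unique up to isomorphism. -/
noncomputable def gradedBetti {V K : Type*} [Field K] (I : Ideal (MvPolynomial V K))
    (i j : ℕ) : ℕ :=
  if h : Nonempty (MinimalGradedFreeResolution I) then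
    Nat.card {b : Fin (h.some.rank i) // h.some.deg i b = j}
  else 0

/-- The Castelnuovo–Mumford regularity `reg(S ⧸ I)`, the maximum of `j - i` over all `i`, `j` with
`b_{i,j}(S ⧸ I) ≠ 0`. It is taken in the extended reals, so that `reg 0 = -∞`. -/
noncomputable def quotientRegularity {V K : Type*} [Field K] (I : Ideal (MvPolynomial V K)) :
    EReal :=
  sSup {r | ∃ i j : ℕ, gradedBetti I i j ≠ 0 ∧ r = (((j : ℝ) - (i : ℝ) : ℝ) : EReal)}

/-! Let `U` be the union of the cover. It suffices to show that `Tor_s(S/I, K)` is nonzero in degree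
`|U|`. This Tor is computed with a resolution of `K` by free modules on all tuples of points of `V`,
repetitions allowed: its strand in multidegree `a` is the augmented ordered chain complex of the
full simplex on the support of `a`, contractible by a cone when `a ≠ 0` (`bdry_cone`).

By minimality each `F i` has a private vertex `v i`. The tuple `v` with coefficient `x^(U \ {v i})`
is a cycle modulo `I`, because dropping `v i` leaves a monomial divisible by that of `F i`. To see
that it is not a boundary, partition `U` into `G i = F i \ ⋃ j > i, F j` and send a tuple `t` to the
determinant of its incidence matrix with the blocks `G i`. This is a cocycle on tuples in `U` with
value `1` on `v`. It kills chains over `I`: by the well ordering, each facet inside `U` contains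
some `G i`, so a facet avoiding `t` forces a zero column (`exists_generator_of_incidence`).

Finally, connecting maps carry the class through the syzygies of `S/I` down to a `0`-chain over the
`s`-th free module, where it exhibits a generator of degree `|U|` (`exists_generator_of_cycle`). -/

namespace FacetIdeal

open Finset MvPolynomial

/-! ### The tuple resolution of the residue field. -/

section Koszul

variable {V : Type*} [DecidableEq V]

/-- The exponent vector of the squarefree monomial `∏ v ∈ A, x_v`. -/
noncomputable def sqfree (A : Finset V) : V →₀ ℕ := ∑ v ∈ A, Finsupp.single v 1

lemma sqfree_apply (A : Finset V) (v : V) : sqfree A v = if v ∈ A then 1 else 0 := by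
  simp [sqfree, Finsupp.finsetSum_apply, Finsupp.single_apply]

lemma sqfree_le_iff {A : Finset V} {a : V →₀ ℕ} : sqfree A ≤ a ↔ A ⊆ a.support := by
  constructor
  · intro h v hv
    have := h v
    rw [sqfree_apply, if_pos hv] at this
    simp
    omega
  · intro h v
    rw [sqfree_apply]
    split_ifs with hv
    · have := h hv
      simp at this
      omega
    · simp

lemma support_sqfree (A : Finset V) : (sqfree A).support = A := by
  ext v
  simp [sqfree_apply]

lemma sqfree_mono {A B : Finset V} (h : A ⊆ B) : sqfree A ≤ sqfree B := by
  rwa [sqfree_le_iff, support_sqfree]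

omit [DecidableEq V] in
lemma degree_sqfree (A : Finset V) : (sqfree A).degree = A.card := by
  simp [sqfree, map_sum]

omit [DecidableEq V] in
lemma monomial_sqfree {K : Type*} [CommSemiring K] (A : Finset V) :
    (monomial (sqfree A) 1 : MvPolynomial V K) = ∏ v ∈ A, X v := by
  simp [sqfree, monomial_sum_one, X]

/-- The set of entries of a tuple. -/
def pts {p : ℕ} (t : Fin p → V) : Finset V := univ.image t

@[simp] lemma mem_pts {p : ℕ} {t : Fin p → V} {v : V} : v ∈ pts t ↔ ∃ i, t i = v := by
  simp [pts]

lemma pts_removeNth_subset {p : ℕ} (t : Fin (p + 1) → V) (i : Fin (p + 1)) :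
    pts (i.removeNth t) ⊆ pts t := by
  intro v
  simp only [mem_pts, Fin.removeNth]
  rintro ⟨j, rfl⟩
  exact ⟨_, rfl⟩

lemma pts_cons {p : ℕ} (v : V) (t : Fin p → V) :
    pts (Fin.cons v t : Fin (p + 1) → V) = insert v (pts t) := by
  ext u
  simp only [mem_pts, mem_insert, Fin.exists_fin_succ, Fin.cons_zero, Fin.cons_succ]
  simp [eq_comm]

variable (K : Type*) [Field K]

/-- The differential of the complex whose `p`-th module is free on the `p`-tuples of points of `V`.
A tuple has the multidegree of its set of entries. -/
noncomputable def bdry (M : Type*) [AddCommGroup M] [Module (MvPolynomial V K) M] (p : ℕ) :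
    ((Fin (p + 1) → V) →₀ M) →ₗ[MvPolynomial V K] ((Fin p → V) →₀ M) :=
  Finsupp.lsum (MvPolynomial V K) fun t => ∑ i : Fin (p + 1),
    (monomial (sqfree (pts t) - sqfree (pts (i.removeNth t))) ((-1 : K) ^ (i : ℕ))) •
      Finsupp.lsingle (i.removeNth t)

variable {K}
variable {M N : Type*} [AddCommGroup M] [Module (MvPolynomial V K) M]
  [AddCommGroup N] [Module (MvPolynomial V K) N]

lemma bdry_single {p : ℕ} (t : Fin (p + 1) → V) (m : M) :
    bdry K M p (Finsupp.single t m) = ∑ i : Fin (p + 1),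
      Finsupp.single (i.removeNth t)
        (monomial (sqfree (pts t) - sqfree (pts (i.removeNth t))) ((-1 : K) ^ (i : ℕ)) • m) := by
  simp [bdry]

/-- The map on tuple complexes induced by a linear map of the coefficients. -/
noncomputable abbrev chainMap (p : ℕ) (f : M →ₗ[MvPolynomial V K] N) :
    ((Fin p → V) →₀ M) →ₗ[MvPolynomial V K] ((Fin p → V) →₀ N) :=
  Finsupp.mapRange.linearMap f

lemma bdry_chainMap {p : ℕ} (f : M →ₗ[MvPolynomial V K] N) (x : (Fin (p + 1) → V) →₀ M) :
    bdry K N p (chainMap (p + 1) f x) = chainMap p f (bdry K M p x) := by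
  induction x using Finsupp.induction_linear with
  | zero => simp only [map_zero]
  | add x y hx hy => simp only [map_add, hx, hy]
  | single t m =>
    simp only [bdry_single, map_sum, chainMap, Finsupp.mapRange.linearMap_apply,
      Finsupp.mapRange_single, map_smul]

/-- The basis element of multidegree `a` on the tuple `t`. -/
noncomputable def cell (K : Type*) [Field K] {p : ℕ} (a : V →₀ ℕ) (t : Fin p → V) :
    (Fin p → V) →₀ MvPolynomial V K :=
  Finsupp.single t (monomial (a - sqfree (pts t)) 1)

lemma bdry_cell {p : ℕ} {a : V →₀ ℕ} {t : Fin (p + 1) → V} (h : sqfree (pts t) ≤ a) :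
    bdry K (MvPolynomial V K) p (cell K a t) =
      ∑ i : Fin (p + 1), (-1 : K) ^ (i : ℕ) • cell K a (i.removeNth t) := by
  rw [cell, bdry_single]
  refine Finset.sum_congr rfl fun i _ => ?_
  rw [cell, smul_eq_mul, monomial_mul, Finsupp.smul_single, smul_monomial]
  have h2 := sqfree_mono (pts_removeNth_subset t i)
  congr 2
  · rw [add_comm, tsub_add_tsub_cancel h h2]

/-- A monomial `u` on a tuple `t` is the cell of multidegree `u + sqfree (pts t)`, so cells span
over `K`. -/
lemma chain_induction {p : ℕ} {P : ((Fin p → V) →₀ MvPolynomial V K) → Prop}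
    (zero : P 0) (add : ∀ x y, P x → P y → P (x + y))
    (smul_cell : ∀ (c : K) (a : V →₀ ℕ) (t : Fin p → V), sqfree (pts t) ≤ a → P (c • cell K a t))
    (x : (Fin p → V) →₀ MvPolynomial V K) : P x := by
  induction x using Finsupp.induction_linear with
  | zero => exact zero
  | add x y hx hy => exact add x y hx hy
  | single t m =>
    induction m using MvPolynomial.induction_on' with
    | monomial u c =>
      have := smul_cell c (u + sqfree (pts t)) t le_add_self
      simpa [cell, smul_monomial] using this
    | add p q hp hq => rw [Finsupp.single_add]; exact add _ _ hp hq

/-- The contracting homotopy which in multidegree `a` is the cone with apex `v a`. -/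
noncomputable def cone (K : Type*) [Field K] (v : (V →₀ ℕ) → V) (p : ℕ) :
    ((Fin p → V) →₀ MvPolynomial V K) →ₗ[K] ((Fin (p + 1) → V) →₀ MvPolynomial V K) :=
  Finsupp.lsum K fun t => (basisMonomials V K).constr K fun u =>
    cell K (u + sqfree (pts t)) (Fin.cons (v (u + sqfree (pts t))) t)

lemma cone_cell (v : (V →₀ ℕ) → V) {p : ℕ} {a : V →₀ ℕ} {t : Fin p → V}
    (h : sqfree (pts t) ≤ a) : cone K v p (cell K a t) = cell K a (Fin.cons (v a) t) := by
  have := (basisMonomials V K).constr_basis K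
    (fun u => cell K (u + sqfree (pts t)) (Fin.cons (v (u + sqfree (pts t))) t))
    (a - sqfree (pts t))
  rw [tsub_add_cancel_of_le h, coe_basisMonomials] at this
  rw [cone, cell, Finsupp.lsum_single]
  exact this

lemma bdry_smul {p : ℕ} (c : K) (x : (Fin (p + 1) → V) →₀ MvPolynomial V K) :
    bdry K (MvPolynomial V K) p (c • x) = c • bdry K (MvPolynomial V K) p x :=
  LinearMap.map_smul_of_tower _ c x

omit [DecidableEq V] in
lemma removeNth_succ_cons {p : ℕ} (v : V) (t : Fin (p + 1) → V) (i : Fin (p + 1)) :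
    i.succ.removeNth (Fin.cons v t : Fin (p + 2) → V) =
      (Fin.cons v (i.removeNth t) : Fin (p + 1) → V) := by
  ext j
  refine Fin.cases ?_ (fun j => ?_) j
  · simp [Fin.removeNth]
  · simp [Fin.removeNth]

lemma cons_mem {p : ℕ} {v : V} {a : V →₀ ℕ} {t : Fin p → V} (h : sqfree (pts t) ≤ a)
    (hv : v ∈ a.support) : sqfree (pts (Fin.cons v t : Fin (p + 1) → V)) ≤ a := by
  rw [sqfree_le_iff] at h ⊢
  rw [pts_cons]
  exact insert_subset hv h

/-- Face `0` of the cone is the original cell; the other faces are cones over its faces, with the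
opposite sign. -/
lemma bdry_cone_cell {v : (V →₀ ℕ) → V} (hv : ∀ a, a ≠ 0 → v a ∈ a.support) {p : ℕ}
    {a : V →₀ ℕ} {t : Fin (p + 1) → V} (h : sqfree (pts t) ≤ a) :
    bdry K _ (p + 1) (cone K v (p + 1) (cell K a t)) + cone K v p (bdry K _ p (cell K a t)) =
      cell K a t := by
  have ha : a ≠ 0 := by
    rintro rfl
    have := sqfree_le_iff.1 h (mem_pts.2 ⟨0, rfl⟩)
    simp at this
  rw [cone_cell v h, bdry_cell h, bdry_cell (cons_mem h (hv a ha)), Fin.sum_univ_succ, map_sum,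
    add_assoc, ← Finset.sum_add_distrib, Finset.sum_eq_zero]
  · simp [Fin.removeNth_zero]
  · intro i _
    rw [map_smul, cone_cell v ((sqfree_mono (pts_removeNth_subset t i)).trans h),
      removeNth_succ_cons, ← add_smul, Fin.val_succ, pow_succ]
    simp

lemma bdry_cone {v : (V →₀ ℕ) → V} (hv : ∀ a, a ≠ 0 → v a ∈ a.support) {p : ℕ}
    (x : (Fin (p + 1) → V) →₀ MvPolynomial V K) :
    bdry K _ (p + 1) (cone K v (p + 1) x) + cone K v p (bdry K _ p x) = x := by
  induction x using chain_induction with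
  | zero => simp
  | add x y hx hy =>
    simp only [map_add]
    rw [add_add_add_comm, hx, hy]
  | smul_cell c a t h => rw [map_smul, bdry_smul, bdry_smul, map_smul, ← smul_add,
      bdry_cone_cell hv h]

/-- The bottom of the homotopy needs `a ≠ 0`: in multidegree `0` the cokernel is the residue field.
-/
lemma bdry_zero_cone_cell {v : (V →₀ ℕ) → V} (hv : ∀ a, a ≠ 0 → v a ∈ a.support)
    {a : V →₀ ℕ} (ha : a ≠ 0) (t : Fin 0 → V) :
    bdry K _ 0 (cone K v 0 (cell K a t)) = cell K a t := by
  have h : sqfree (pts t) ≤ a := by simp [sqfree_le_iff, pts]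
  rw [cone_cell v h, bdry_cell (cons_mem h (hv a ha))]
  simp [Fin.removeNth_zero]

lemma exists_apex [Nonempty V] : ∃ v : (V →₀ ℕ) → V, ∀ a, a ≠ 0 → v a ∈ a.support := by
  refine ⟨fun a => if h : a = 0 then Classical.arbitrary V else
    (Finsupp.support_nonempty_iff.2 h).choose, fun a ha => ?_⟩
  simp only [ha, dite_false]
  exact (Finsupp.support_nonempty_iff.2 ha).choose_spec

/-- Apexes may be chosen separately in each multidegree, so any nonempty cell is the cone over its
tail. This lets `∂∂ = 0` be derived from the homotopy identity instead of from the simplicial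
identities. -/
lemma exists_cone_eq_cell {p : ℕ} {a : V →₀ ℕ} {t : Fin (p + 1) → V} (h : sqfree (pts t) ≤ a) :
    ∃ v : (V →₀ ℕ) → V, (∀ b, b ≠ 0 → v b ∈ b.support) ∧
      cone K v p (cell K a (Fin.tail t)) = cell K a t := by
  have : Nonempty V := ⟨t 0⟩
  obtain ⟨v, hv⟩ := exists_apex (V := V)
  have h2 : sqfree (pts (Fin.tail t)) ≤ a := by
    refine (sqfree_mono ?_).trans h
    intro u
    simp only [mem_pts, Fin.tail]
    rintro ⟨j, rfl⟩
    exact ⟨_, rfl⟩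
  refine ⟨Function.update v a (t 0), fun b hb => ?_, ?_⟩
  · by_cases hab : b = a
    · subst hab
      rw [Function.update_self]
      exact sqfree_le_iff.1 h (mem_pts.2 ⟨0, rfl⟩)
    · rw [Function.update_of_ne hab]
      exact hv b hb
  · rw [cone_cell _ h2, Function.update_self, Fin.cons_self_tail]

/-- Write the cell as a cone `c y`. Using `∂c = 1 - c∂` twice gives `∂∂(c y) = c(∂∂y)`, which
vanishes by induction; at the bottom, `∂c = 1` on empty tuples of nonzero multidegree. -/
lemma bdry_bdry_polynomial {p : ℕ} (x : (Fin (p + 2) → V) →₀ MvPolynomial V K) :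
    bdry K _ p (bdry K _ (p + 1) x) = 0 := by
  induction p with
  | zero =>
    induction x using chain_induction with
    | zero => simp
    | add x y hx hy => simp only [map_add, hx, hy, add_zero]
    | smul_cell c a t h =>
      obtain ⟨v, hv, hc⟩ := exists_cone_eq_cell (K := K) h
      have ha : a ≠ 0 := by
        rintro rfl
        have := sqfree_le_iff.1 h (mem_pts.2 ⟨0, rfl⟩)
        simp at this
      have h2 : sqfree (pts (Fin.tail t)) ≤ a :=
        (sqfree_mono (by simpa [Fin.removeNth_zero] using pts_removeNth_subset t 0)).trans h
      rw [bdry_smul, bdry_smul, ← hc, eq_sub_of_add_eq (bdry_cone hv _), map_sub, bdry_cell h2]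
      simp only [map_sum, map_smul, bdry_smul]
      simp [bdry_zero_cone_cell hv ha]
  | succ p ih =>
    induction x using chain_induction with
    | zero => simp
    | add x y hx hy => simp only [map_add, hx, hy, add_zero]
    | smul_cell c a t h =>
      obtain ⟨v, hv, hc⟩ := exists_cone_eq_cell (K := K) h
      rw [bdry_smul, bdry_smul, ← hc, eq_sub_of_add_eq (bdry_cone hv _), map_sub,
        eq_sub_of_add_eq (bdry_cone hv (bdry K _ (p + 1) _)), ih]
      simp

lemma bdry_bdry {p : ℕ} (x : (Fin (p + 2) → V) →₀ M) :
    bdry K M p (bdry K M (p + 1) x) = 0 := by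
  induction x using Finsupp.induction_linear with
  | zero => simp
  | add x y hx hy => simp only [map_add, hx, hy, add_zero]
  | single t m =>
    have : Finsupp.single t m = chainMap (p + 2) (LinearMap.toSpanSingleton (MvPolynomial V K) M m)
        (Finsupp.single t 1) := by simp
    rw [this, bdry_chainMap, bdry_chainMap, bdry_bdry_polynomial, map_zero]

lemma exists_bdry_eq_polynomial {p : ℕ} {x : (Fin (p + 1) → V) →₀ MvPolynomial V K}
    (hx : bdry K _ p x = 0) : ∃ y, bdry K _ (p + 1) y = x := by
  rcases isEmpty_or_nonempty V with hV | hV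
  · exact ⟨0, by ext t; exact hV.elim (t 0)⟩
  · obtain ⟨v, hv⟩ := exists_apex (V := V)
    refine ⟨cone K v (p + 1) x, ?_⟩
    simpa [hx] using bdry_cone hv x

lemma exists_bdry_eq {n p : ℕ} {x : (Fin (p + 1) → V) →₀ (Fin n → MvPolynomial V K)}
    (hx : bdry K _ p x = 0) : ∃ y, bdry K _ (p + 1) y = x := by
  have (b : Fin n) := exists_bdry_eq_polynomial (x := chainMap (p + 1) (LinearMap.proj b) x)
    (by rw [bdry_chainMap, hx, map_zero])
  choose y hy using this
  refine ⟨∑ b, chainMap (p + 2)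
    (LinearMap.single (MvPolynomial V K) (fun _ : Fin n => MvPolynomial V K) b) (y b), ?_⟩
  rw [map_sum]
  simp only [bdry_chainMap, hy]
  refine Finsupp.ext fun t => ?_
  rw [Finsupp.finsetSum_apply]
  simpa using Finset.univ_sum_single (x t)

lemma exists_bdry_zero_eq [Fintype V] {n : ℕ} {x : (Fin 0 → V) →₀ (Fin n → MvPolynomial V K)}
    (hx : ∀ t b, x t b ∈ Ideal.span (Set.range (X : V → MvPolynomial V K))) :
    ∃ y, bdry K _ 0 y = x := by
  have (b : Fin n) := Ideal.mem_span_range_iff_exists_fun.1 (hx default b)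
  choose c hc using this
  refine ⟨∑ v : V, Finsupp.single (fun _ => v) (fun b => c b v), ?_⟩
  rw [map_sum]
  refine Finsupp.ext fun t => ?_
  obtain rfl : t = default := Subsingleton.elim _ _
  rw [Finsupp.finsetSum_apply]
  ext1 b
  rw [← hc b, Finset.sum_apply]
  refine Finset.sum_congr rfl fun v _ => ?_
  rw [bdry_single]
  have h1 : sqfree (pts fun _ : Fin 1 => v) = Finsupp.single v 1 := by simp [pts, sqfree]
  have h2 (t : Fin 0 → V) : sqfree (pts t) = 0 := by simp [pts, sqfree]
  have h3 : (Fin.removeNth 0 fun _ : Fin (0 + 1) => v) = (default : Fin 0 → V) :=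
    Subsingleton.elim _ _
  simp [h1, h2, h3, mul_comm, X]

/-- A tuple chain is a cycle; in degree `0` every chain is. -/
def IsCycle (K : Type*) [Field K] {M : Type*} [AddCommGroup M] [Module (MvPolynomial V K) M] :
    (p : ℕ) → ((Fin p → V) →₀ M) → Prop
  | 0, _ => True
  | p + 1, x => bdry K M p x = 0

end Koszul

/-! ### Homogeneous elements, maps and submodules of graded free modules. -/

section Graded

variable {V K : Type*} [Field K] {ι κ : Type*}

/-- The homogeneous component of degree `j` in the free module on generators of degrees `w`. -/
noncomputable def trunc (w : ι → ℕ) (j : ℕ) :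
    (ι → MvPolynomial V K) →ₗ[K] (ι → MvPolynomial V K) :=
  LinearMap.pi fun b => if w b ≤ j then
    homogeneousComponent (j - w b) ∘ₗ LinearMap.proj b else 0

lemma coeff_trunc (w : ι → ℕ) (j : ℕ) (r : ι → MvPolynomial V K) (b : ι) (u : V →₀ ℕ) :
    coeff u (trunc w j r b) = if u.degree + w b = j then coeff u (r b) else 0 := by
  by_cases h : w b ≤ j
  · simp only [trunc, LinearMap.pi_apply, if_pos h, LinearMap.comp_apply, LinearMap.proj_apply,
      coeff_homogeneousComponent]
    congr 1
    exact propext (by omega)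
  · simp only [trunc, LinearMap.pi_apply, if_neg h]
    rw [if_neg (by omega)]
    simp

/-- Homogeneous elements of degree `j` in the free module on generators of degrees `w`. -/
def IsHomogeneousElt (w : ι → ℕ) (j : ℕ) (r : ι → MvPolynomial V K) : Prop :=
  ∀ b u, coeff u (r b) ≠ 0 → u.degree + w b = j

lemma isHomogeneousElt_trunc (w : ι → ℕ) (j : ℕ) (r : ι → MvPolynomial V K) :
    IsHomogeneousElt w j (trunc w j r) := by
  intro b u h
  rw [coeff_trunc] at h
  by_contra h2
  exact h (if_neg h2)

lemma IsHomogeneousElt.trunc_eq {w : ι → ℕ} {j : ℕ} {r : ι → MvPolynomial V K}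
    (h : IsHomogeneousElt w j r) : trunc w j r = r := by
  ext b u
  rw [coeff_trunc]
  split_ifs with h2
  · rfl
  · by_contra h3
    exact h2 (h b u (Ne.symm h3))

lemma IsHomogeneousElt.zero (w : ι → ℕ) (j : ℕ) :
    IsHomogeneousElt w j (0 : ι → MvPolynomial V K) := by
  intro b u h
  simp at h

lemma IsHomogeneousElt.add {w : ι → ℕ} {j : ℕ} {r s : ι → MvPolynomial V K}
    (hr : IsHomogeneousElt w j r) (hs : IsHomogeneousElt w j s) :
    IsHomogeneousElt w j (r + s) := by
  intro b u h
  by_cases h2 : coeff u (r b) = 0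
  · refine hs b u fun h3 => h ?_
    simp [h2, h3]
  · exact hr b u h2

lemma IsHomogeneousElt.monomial_smul {w : ι → ℕ} {j : ℕ} {r : ι → MvPolynomial V K}
    (hr : IsHomogeneousElt w j r) (u : V →₀ ℕ) (c : K) :
    IsHomogeneousElt w (u.degree + j) (monomial u c • r) := by
  intro b x h
  rw [Pi.smul_apply, smul_eq_mul, coeff_monomial_mul'] at h
  split_ifs at h with hux
  · have := hr b _ (right_ne_zero_of_mul h)
    have h2 : x.degree = u.degree + (x - u).degree := by
      rw [← map_add, add_tsub_cancel_of_le hux]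
    omega
  · simp at h

lemma IsHomogeneousElt.single [DecidableEq ι] (w : ι → ℕ) (b : ι) :
    IsHomogeneousElt w (w b) (Pi.single b (1 : MvPolynomial V K)) := by
  intro c u h
  by_cases hcb : c = b
  · subst hcb
    classical
    rw [Pi.single_eq_same, coeff_one] at h
    have : u = 0 := by
      by_contra h2
      exact h (if_neg (Ne.symm h2))
    simp [this]
  · simp [Pi.single_eq_of_ne hcb] at h

lemma IsHomogeneousElt.trunc_of_ne {w : ι → ℕ} {i j : ℕ} {r : ι → MvPolynomial V K}
    (h : IsHomogeneousElt w i r) (hij : i ≠ j) : trunc w j r = 0 := by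
  ext b u
  rw [coeff_trunc]
  split_ifs with h2
  · by_contra h3
    exact hij ((h b u h3).symm.trans h2)
  · simp

/-- Homogeneous maps of degree `0` between graded free modules. -/
def IsGradedMap [DecidableEq ι] (w : ι → ℕ) (w' : κ → ℕ)
    (f : (ι → MvPolynomial V K) →ₗ[MvPolynomial V K] (κ → MvPolynomial V K)) : Prop :=
  ∀ b, IsHomogeneousElt w' (w b) (f (Pi.single b 1))

lemma IsGradedMap.trunc [DecidableEq ι] [Finite ι] {w : ι → ℕ} {w' : κ → ℕ}
    {f : (ι → MvPolynomial V K) →ₗ[MvPolynomial V K] (κ → MvPolynomial V K)}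
    (hf : IsGradedMap w w' f) (j : ℕ) (r : ι → MvPolynomial V K) :
    f (trunc w j r) = FacetIdeal.trunc w' j (f r) := by
  suffices h : f.restrictScalars K ∘ₗ FacetIdeal.trunc w j =
      FacetIdeal.trunc w' j ∘ₗ f.restrictScalars K from LinearMap.congr_fun h r
  refine LinearMap.pi_ext' fun b => 
    (basisMonomials V K).ext fun u => ?_
  have key : (Pi.single b (monomial u (1 : K)) : ι → MvPolynomial V K) =
      monomial u (1 : K) • Pi.single b 1 := by
    rw [← Pi.single_smul, smul_eq_mul, mul_one]
  simp only [LinearMap.comp_apply, LinearMap.restrictScalars_apply, LinearMap.single_apply,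
    coe_basisMonomials]
  rw [key]
  have h1 : IsHomogeneousElt w (u.degree + w b)
      (monomial u (1 : K) • (Pi.single b 1 : ι → MvPolynomial V K)) :=
    (IsHomogeneousElt.single w b).monomial_smul u 1
  have h2 := (hf b).monomial_smul u 1
  rw [← map_smul] at h2
  by_cases hj : u.degree + w b = j
  · subst hj
    rw [h1.trunc_eq, h2.trunc_eq]
  · rw [h1.trunc_of_ne hj, h2.trunc_of_ne hj, map_zero]

lemma sum_trunc [Fintype ι] (w : ι → ℕ) (r : ι → MvPolynomial V K) :
    ∃ J, ∑ j ∈ range J, trunc w j r = r := by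
  -- A crude bound: this sum exceeds the shifted degree of every monomial occurring in `r`.
  refine ⟨∑ b, ((r b).totalDegree + w b + 1), ?_⟩
  ext b u
  rw [Finset.sum_apply, coeff_sum]
  simp only [coeff_trunc]
  rw [Finset.sum_ite_eq]
  split_ifs with h
  · rfl
  · by_contra h2
    have h3 := le_totalDegree (mem_support_iff.2 (Ne.symm h2))
    have h4 := Finset.single_le_sum (f := fun b => (r b).totalDegree + w b + 1)
      (fun _ _ => Nat.zero_le _) (mem_univ b)
    rw [mem_range] at h
    have h5 : u.degree = u.sum fun _ e => e := rfl
    omega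

/-- Homogeneous submodules of a graded free module. -/
def IsGradedSubmodule (w : ι → ℕ) (N : Submodule (MvPolynomial V K) (ι → MvPolynomial V K)) :
    Prop :=
  ∀ j, ∀ r ∈ N, trunc w j r ∈ N

lemma IsGradedMap.ker [DecidableEq ι] [Finite ι] {w : ι → ℕ} {w' : κ → ℕ}
    {f : (ι → MvPolynomial V K) →ₗ[MvPolynomial V K] (κ → MvPolynomial V K)}
    (hf : IsGradedMap w w' f) : IsGradedSubmodule w (LinearMap.ker f) := by
  intro j r hr
  rw [LinearMap.mem_ker] at hr ⊢
  rw [hf.trunc, hr, map_zero]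

lemma mem_span_X_of_coeff_zero {f : MvPolynomial V K} (hf : coeff 0 f = 0) :
    f ∈ Ideal.span (Set.range (X : V → MvPolynomial V K)) := by
  rw [← Set.image_univ, mem_ideal_span_X_image]
  intro u hu
  have : u ≠ 0 := by
    rintro rfl
    exact (mem_support_iff.1 hu) hf
  obtain ⟨v, hv⟩ := Finsupp.ne_iff.1 this
  exact ⟨v, trivial, hv⟩

/-! ### Existence of minimal graded free resolutions. -/

/-- The submodule `N` is generated by `m` homogeneous elements. -/
def HasHomogeneousGenerators (w : ι → ℕ)
    (N : Submodule (MvPolynomial V K) (ι → MvPolynomial V K)) (m : ℕ) : Prop :=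
  ∃ (δ : Fin m → ℕ) (g : Fin m → ι → MvPolynomial V K),
    (∀ b, IsHomogeneousElt w (δ b) (g b)) ∧ Submodule.span _ (Set.range g) = N

lemma exists_hasHomogeneousGenerators [Finite V] [Finite ι] {w : ι → ℕ}
    {N : Submodule (MvPolynomial V K) (ι → MvPolynomial V K)} (hN : IsGradedSubmodule w N) :
    ∃ m, HasHomogeneousGenerators w N m := by
  have := Fintype.ofFinite ι
  let s : Set (ι → MvPolynomial V K) := {r | r ∈ N ∧ ∃ j, IsHomogeneousElt w j r}
  have hs : Submodule.span (MvPolynomial V K) s = N := by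
    apply le_antisymm
    · exact Submodule.span_le.2 fun r hr => hr.1
    · intro r hr
      obtain ⟨J, hJ⟩ := sum_trunc w r
      rw [← hJ]
      exact Submodule.sum_mem _ fun j _ => Submodule.subset_span
        ⟨hN j r hr, j, isHomogeneousElt_trunc w j r⟩
  have hfg : (Submodule.span (MvPolynomial V K) s).FG := IsNoetherian.noetherian _
  obtain ⟨t, hts, ht⟩ := (Submodule.fg_span_iff_fg_span_finset_subset s).1 hfg
  let e := t.equivFin.symm
  have h (b : Fin t.card) : ∃ j, IsHomogeneousElt w j (e b : ι → MvPolynomial V K) :=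
    (hts (e b).2).2
  choose δ hδ using h
  refine ⟨t.card, δ, fun b => e b, hδ, ?_⟩
  rw [← hs, ht]
  congr 1
  ext r
  constructor
  · rintro ⟨b, rfl⟩
    exact (e b).2
  · intro hr
    exact ⟨e.symm ⟨r, hr⟩, by simp⟩

lemma trunc_zero_apply (j : ℕ) (r : ι → MvPolynomial V K) (b : ι) :
    trunc (fun _ => 0) j r b = homogeneousComponent j (r b) := by
  ext u
  rw [coeff_trunc, coeff_homogeneousComponent, add_zero]

/-- A minimal homogeneous presentation of a homogeneous submodule of a graded free module. -/
lemma exists_minimal_cover [Finite V] [Finite ι] {w : ι → ℕ}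
    {N : Submodule (MvPolynomial V K) (ι → MvPolynomial V K)} (hN : IsGradedSubmodule w N) :
    ∃ (m : ℕ) (δ : Fin m → ℕ)
      (f : (Fin m → MvPolynomial V K) →ₗ[MvPolynomial V K] (ι → MvPolynomial V K)),
      LinearMap.range f = N ∧ IsGradedMap δ w f ∧
      ∀ r ∈ LinearMap.ker f, ∀ b, r b ∈ Ideal.span (Set.range (X : V → MvPolynomial V K)) := by
  classical
  -- Take the least possible number of homogeneous generators; a relation with a nonzero constant
  -- coefficient would make one of them redundant.
  have hex := exists_hasHomogeneousGenerators hN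
  obtain ⟨δ, g, hg, hspan⟩ := Nat.find_spec hex
  have hmin := fun k => Nat.find_min hex (m := k)
  generalize Nat.find hex = m at δ g hg hspan hmin
  let f := Fintype.linearCombination (MvPolynomial V K) g
  have hsingle (b : Fin m) : f (Pi.single b 1) = g b := by
    simp [f, Fintype.linearCombination_apply_single]
  have hgr : IsGradedMap δ w f := by
    intro b
    rw [hsingle]
    exact hg b
  refine ⟨m, δ, f, by rw [Fintype.range_linearCombination, hspan], hgr, ?_⟩
  intro r hr b
  apply mem_span_X_of_coeff_zero
  by_contra hne
  have hr2 := hgr.ker (δ b) r hr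
  -- In the component of the relation in degree `δ b`, the coefficient of generator `b` has
  -- polynomial degree `0`, hence is a unit.
  have hb : trunc δ (δ b) r b = C (coeff 0 (r b)) := by
    ext u
    rw [coeff_trunc, coeff_C]
    by_cases hu : u = 0
    · simp [hu]
    · have : u.degree ≠ 0 := fun h => hu ((Finsupp.degree_eq_zero_iff u).1 h)
      rw [if_neg (by omega), if_neg (Ne.symm hu)]
  obtain ⟨q, hq⟩ : ∃ q : Fin m → MvPolynomial V K, q = trunc δ (δ b) r := ⟨_, rfl⟩
  rw [← hq] at hr2 hb
  obtain _ | n := m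
  · exact b.elim0
  apply hmin n (Nat.lt_succ_self n)
  refine ⟨fun i => δ (b.succAbove i), fun i => g (b.succAbove i), fun i => hg _, ?_⟩
  rw [← hspan]
  apply le_antisymm
  · exact Submodule.span_mono (by rintro _ ⟨i, rfl⟩; exact ⟨_, rfl⟩)
  · rw [Submodule.span_le]
    rintro _ ⟨c, rfl⟩
    rcases Fin.eq_self_or_eq_succAbove b c with rfl | ⟨i, rfl⟩
    · have h0 : ∑ i, q i • g i = 0 := hr2
      rw [Fin.sum_univ_succAbove _ c, hb] at h0
      have h1 : g c = (C (coeff 0 (r c))⁻¹ : MvPolynomial V K) • -∑ i, q (c.succAbove i) • g (c.succAbove i) := by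
        rw [← eq_neg_of_add_eq_zero_left h0, smul_smul, ← C_mul, inv_mul_cancel₀ hne, C_1, one_smul]
      rw [h1]
      refine Submodule.smul_mem _ _ (Submodule.neg_mem _ (Submodule.sum_mem _ fun i _ =>
        Submodule.smul_mem _ _ (Submodule.subset_span ⟨i, rfl⟩)))
    · exact Submodule.subset_span ⟨i, rfl⟩

/-- A homogeneous submodule of a graded free module contained in `𝔪` times that module. -/
structure Syzygies (V K : Type*) [Field K] where
  /-- the rank of the free module -/
  rank : ℕ
  /-- the degrees of its generators -/
  deg : Fin rank → ℕ
  /-- the submodule -/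
  N : Submodule (MvPolynomial V K) (Fin rank → MvPolynomial V K)
  graded : IsGradedSubmodule deg N
  le : ∀ r ∈ N, ∀ b, r b ∈ Ideal.span (Set.range (X : V → MvPolynomial V K))

/-- The next step of the minimal resolution. -/
lemma Syzygies.exists_next [Finite V] (Z : Syzygies V K) : ∃ (Y : Syzygies V K)
    (f : (Fin Y.rank → MvPolynomial V K) →ₗ[MvPolynomial V K] (Fin Z.rank → MvPolynomial V K)),
    LinearMap.range f = Z.N ∧ IsGradedMap Y.deg Z.deg f ∧ LinearMap.ker f = Y.N := by
  obtain ⟨m, δ, f, h1, h2, h3⟩ := exists_minimal_cover Z.graded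
  exact ⟨⟨m, δ, LinearMap.ker f, h2.ker, h3⟩, f, h1, h2, rfl⟩

/-- A proper homogeneous ideal has a minimal graded free resolution. -/
theorem nonempty_minimalGradedFreeResolution [Finite V] {I : Ideal (MvPolynomial V K)}
    (hI : ∀ f ∈ I, ∀ j, homogeneousComponent j f ∈ I) (hI' : ∀ f ∈ I, coeff 0 f = 0) :
    Nonempty (MinimalGradedFreeResolution I) := by
  let Z₀ : Syzygies V K :=
    { rank := 1
      deg := fun _ => 0
      N := Submodule.comap (LinearMap.proj 0 : (Fin 1 → MvPolynomial V K) →ₗ[MvPolynomial V K] MvPolynomial V K) I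
      graded := by
        intro j r hr
        rw [Submodule.mem_comap] at hr ⊢
        simp only [LinearMap.proj_apply] at hr ⊢
        rw [trunc_zero_apply]
        exact hI _ hr j
      le := by
        intro r hr b
        obtain rfl : b = 0 := Subsingleton.elim _ _
        exact mem_span_X_of_coeff_zero (hI' _ hr) }
  choose next f hrange hgr hker using Syzygies.exists_next (V := V) (K := K)
  -- Each kernel lies in `𝔪` times its free module, which is exactly the minimality of the next
  -- differential.
  let Y : ℕ → Syzygies V K := fun i => Nat.rec Z₀ (fun _ z => next z) i
  exact ⟨{
    rank := fun i => (Y i).rank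
    deg := fun i => (Y i).deg
    d := fun i => f (Y i)
    aug := (Submodule.mkQ I) ∘ₗ LinearMap.proj (0 : Fin 1)
    aug_surjective := (Submodule.mkQ_surjective I).comp (Function.surjective_eval (0 : Fin 1))
    exact_aug := by
      rw [LinearMap.exact_iff, hrange (Y 0), LinearMap.ker_comp, Submodule.ker_mkQ]
      rfl
    exact_d := fun i => by
      rw [LinearMap.exact_iff, hrange (Y (i + 1)), hker (Y i)]
    aug_graded := fun b => by
      refine ⟨1, isHomogeneous_one V K, ?_⟩
      obtain rfl : b = (0 : Fin 1) := Subsingleton.elim (α := Fin 1) _ _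
      simp
    d_graded := fun i b c u hu => hgr (Y i) b c u (mem_support_iff.1 hu)
    minimal := fun i x c => by
      refine (Y i).le _ ?_ c
      rw [← hrange (Y i)]
      exact ⟨x, rfl⟩ }⟩

end Graded

/-! ### Dimension shifting from cycles over `S ⧸ I` to generators of the resolution. -/

section Lifting

variable {V K : Type*} [DecidableEq V] [Field K] {ι κ : Type*}

/-- Homogeneous tuple chains of degree `j` with coefficients in a graded free module. -/
def IsHomogeneousChain (w : ι → ℕ) (j : ℕ) {p : ℕ}
    (z : (Fin p → V) →₀ (ι → MvPolynomial V K)) : Prop :=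
  ∀ t, IsHomogeneousElt (fun b => w b + (pts t).card) j (z t)

omit [DecidableEq V] in
lemma IsHomogeneousElt.sum {α : Type*} {w : ι → ℕ} {j : ℕ} {s : Finset α}
    {r : α → ι → MvPolynomial V K} (h : ∀ a ∈ s, IsHomogeneousElt w j (r a)) :
    IsHomogeneousElt w j (∑ a ∈ s, r a) :=
  Finset.sum_induction _ _ (fun _ _ => IsHomogeneousElt.add) (IsHomogeneousElt.zero w j) h

lemma IsHomogeneousChain.bdry {w : ι → ℕ} {j p : ℕ}
    {z : (Fin (p + 1) → V) →₀ (ι → MvPolynomial V K)} (hz : IsHomogeneousChain w j z) :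
    IsHomogeneousChain w j (bdry K _ p z) := by
  intro t
  rw [← Finsupp.sum_single z, Finsupp.sum, map_sum, Finsupp.finsetSum_apply]
  refine IsHomogeneousElt.sum fun t' _ => ?_
  rw [bdry_single, Finsupp.finsetSum_apply]
  refine IsHomogeneousElt.sum fun i _ => ?_
  rw [Finsupp.single_apply]
  split_ifs with h
  · subst h
    intro b u hu
    have h1 := (hz t').monomial_smul _ _ b u hu
    have h2 : (sqfree (pts t') - sqfree (pts (i.removeNth t'))).degree +
        (pts (i.removeNth t')).card = (pts t').card := by
      rw [← degree_sqfree, ← degree_sqfree, ← map_add,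
        tsub_add_cancel_of_le (sqfree_mono (pts_removeNth_subset t' i))]
    simp only at h1 ⊢
    omega
  · exact IsHomogeneousElt.zero _ _

/-- Any lift can be truncated tuple by tuple: shifting source and target degrees by `(pts t).card`
keeps `f` graded. -/
lemma exists_homogeneous_lift [Fintype V] [DecidableEq ι] [Finite ι] {w : ι → ℕ} {w' : κ → ℕ}
    {f : (ι → MvPolynomial V K) →ₗ[MvPolynomial V K] (κ → MvPolynomial V K)}
    (hf : IsGradedMap w w' f) {j p : ℕ} {z : (Fin p → V) →₀ (κ → MvPolynomial V K)}
    (hz : IsHomogeneousChain w' j z) (hr : ∀ t, z t ∈ LinearMap.range f) :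
    ∃ y, IsHomogeneousChain w j y ∧ chainMap p f y = z := by
  choose r hr using hr
  refine ⟨Finsupp.equivFunOnFinite.symm fun t => trunc (fun b => w b + (pts t).card) j (r t),
    fun t => isHomogeneousElt_trunc _ _ _, Finsupp.ext fun t => ?_⟩
  have hft : IsGradedMap (fun b => w b + (pts t).card) (fun c => w' c + (pts t).card) f := by
    intro b c u hu
    have := hf b c u hu
    simp only
    omega
  rw [chainMap, Finsupp.mapRange.linearMap_apply, Finsupp.mapRange_apply,
    Finsupp.equivFunOnFinite_symm_apply_apply, hft.trunc, hr, (hz t).trunc_eq]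

/-- The connecting map on homology of tuple chains preserves non-boundaries. -/
lemma exists_connecting [Fintype V] [DecidableEq ι] [Finite ι] {n : ℕ} {w : ι → ℕ}
    {w' : Fin n → ℕ} {M : Type*} [AddCommGroup M] [Module (MvPolynomial V K) M]
    {f : (ι → MvPolynomial V K) →ₗ[MvPolynomial V K] (Fin n → MvPolynomial V K)}
    {g : (Fin n → MvPolynomial V K) →ₗ[MvPolynomial V K] M}
    (hf : IsGradedMap w w' f) (hfg : Function.Exact f g) {j p : ℕ}
    {z : (Fin (p + 1) → V) →₀ (Fin n → MvPolynomial V K)} (hz : IsHomogeneousChain w' j z)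
    (hc : IsCycle K (p + 1) (chainMap (p + 1) g z))
    (hne : ¬∃ y, chainMap (p + 1) g z = bdry K M (p + 1) (chainMap (p + 2) g y)) :
    ∃ z' : (Fin p → V) →₀ (ι → MvPolynomial V K), IsHomogeneousChain w j z' ∧
      IsCycle K p (chainMap p f z') ∧
      ¬∃ y, chainMap p f z' = bdry K _ p (chainMap (p + 1) f y) := by
  have hc' : chainMap p g (bdry K _ p z) = 0 := by
    rw [← bdry_chainMap]
    exact hc
  obtain ⟨z', hz', hfz⟩ := exists_homogeneous_lift hf hz.bdry fun t => by
    rw [← LinearMap.exact_iff.1 hfg, LinearMap.mem_ker]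
    exact DFunLike.congr_fun hc' t
  refine ⟨z', hz', ?_, ?_⟩
  · rw [hfz]
    cases p with
    | zero => trivial
    | succ p => exact bdry_bdry z
  · rintro ⟨y, hy⟩
    -- If the image were a boundary, correcting `z` by `f y` would give a cycle over a free module,
    -- hence a boundary, and applying `g` would make the original class trivial.
    have h1 : bdry K _ p (z - chainMap (p + 1) f y) = 0 := by
      rw [map_sub, ← hy, hfz, sub_self]
    obtain ⟨x, hx⟩ := exists_bdry_eq h1
    refine hne ⟨x, ?_⟩
    have h2 : chainMap (p + 1) g (chainMap (p + 1) f y) = 0 := by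
      refine Finsupp.ext fun t => ?_
      exact hfg.apply_apply_eq_zero (y t)
    rw [bdry_chainMap, hx, map_sub, h2, sub_zero]

/-- Boundaries among `0`-chains over a free module are the elements with all entries in `𝔪`. A
homogeneous element of degree `j` has a nonzero constant term only at a generator of degree `j`. -/
lemma exists_generator_of_degree [Fintype V] {n : ℕ} {w : Fin n → ℕ} {M : Type*} [AddCommGroup M]
    [Module (MvPolynomial V K) M] {g : (Fin n → MvPolynomial V K) →ₗ[MvPolynomial V K] M}
    {j : ℕ} {z : (Fin 0 → V) →₀ (Fin n → MvPolynomial V K)} (hz : IsHomogeneousChain w j z)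
    (hne : ¬∃ y, chainMap 0 g z = bdry K M 0 (chainMap 1 g y)) : ∃ b, w b = j := by
  by_contra! h
  obtain ⟨y, hy⟩ : ∃ y, bdry K _ 0 y = z := by
    refine exists_bdry_zero_eq fun t b => mem_span_X_of_coeff_zero ?_
    by_contra h2
    have := hz t b 0 h2
    apply h b
    simpa [pts] using this
  exact hne ⟨y, by rw [bdry_chainMap, hy]⟩

variable {I : Ideal (MvPolynomial V K)}

omit [DecidableEq V] in
lemma isGradedMap_d (R : MinimalGradedFreeResolution I) (i : ℕ) :
    IsGradedMap (R.deg (i + 1)) (R.deg i) (R.d i) :=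
  fun b c u hu => R.d_graded i b c u (mem_support_iff.2 hu)

/-- The class lives over the image of `R.d k`. Each connecting map lowers `p` and raises `k` by one,
preserving `k + 1 + p` and the internal degree `j`. -/
lemma exists_generator_of_degree_of_d [Fintype V] (R : MinimalGradedFreeResolution I) (j p : ℕ) :
    ∀ (k i : ℕ), i = k + 1 + p →
    ∀ z : (Fin p → V) →₀ (Fin (R.rank (k + 1)) → MvPolynomial V K),
      IsHomogeneousChain (R.deg (k + 1)) j z → IsCycle K p (chainMap p (R.d k) z) →
      (¬∃ y, chainMap p (R.d k) z = bdry K _ p (chainMap (p + 1) (R.d k) y)) →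
      ∃ b, R.deg i b = j := by
  induction p with
  | zero =>
    rintro k i rfl z hz - hne
    exact exists_generator_of_degree hz hne
  | succ p ih =>
    rintro k i hi z hz hc hne
    obtain ⟨z', h1, h2, h3⟩ :=
      exists_connecting (isGradedMap_d R (k + 1)) (R.exact_d k) hz hc hne
    exact ih (k + 1) i (by omega) z' h1 h2 h3

/-- A homogeneous `p`-cycle over `S ⧸ I` which is not a boundary forces a generator of the same
degree in homological degree `p` of the resolution. -/
lemma exists_generator_of_cycle [Fintype V] (R : MinimalGradedFreeResolution I) {j p : ℕ}
    {z : (Fin p → V) →₀ (Fin (R.rank 0) → MvPolynomial V K)}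
    (hz : IsHomogeneousChain (R.deg 0) j z) (hc : IsCycle K p (chainMap p R.aug z))
    (hne : ¬∃ y, chainMap p R.aug z = bdry K _ p (chainMap (p + 1) R.aug y)) :
    ∃ b, R.deg p b = j := by
  cases p with
  | zero => exact exists_generator_of_degree hz hne
  | succ p =>
    obtain ⟨z', h1, h2, h3⟩ := exists_connecting (isGradedMap_d R 0) R.exact_aug hz hc hne
    exact exists_generator_of_degree_of_d R j p 0 (p + 1) (by omega) z' h1 h2 h3

omit [DecidableEq V] in
/-- Homogeneous elements of `S ⧸ I` lift to homogeneous elements along the augmentation. -/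
lemma exists_homogeneous_aug_eq (R : MinimalGradedFreeResolution I)
    (hI : ∀ f ∈ I, ∀ j, homogeneousComponent j f ∈ I) {j : ℕ} {m : MvPolynomial V K}
    (hm : m.IsHomogeneous j) :
    ∃ r, IsHomogeneousElt (R.deg 0) j r ∧ R.aug r = Ideal.Quotient.mk I m := by
  choose f hf hfaug using R.aug_graded
  -- The augmentation factors through a graded map to `S` itself, written as `Fin 1 → S`; as `I` is
  -- homogeneous, truncating any lift of `m` is again a lift.
  let Φ : (Fin (R.rank 0) → MvPolynomial V K) →ₗ[MvPolynomial V K] (Fin 1 → MvPolynomial V K) :=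
    LinearMap.pi fun _ => Fintype.linearCombination (MvPolynomial V K) f
  have hΦ : IsGradedMap (R.deg 0) (fun _ => 0) Φ := by
    intro b c u hu
    have h1 : Φ (Pi.single b 1) c = f b := by
      simp [Φ, Fintype.linearCombination_apply_single]
    rw [h1] at hu
    have := hf b hu
    rw [Finsupp.degree_eq_weight_one]
    exact this
  have haug (r) : R.aug r = Ideal.Quotient.mk I (Φ r 0) := by
    rw [LinearMap.pi_apply_eq_sum_univ R.aug r]
    simp only [Φ, LinearMap.pi_apply, Fintype.linearCombination_apply, map_sum, smul_eq_mul,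
      map_mul, hfaug]
    refine Finset.sum_congr rfl fun b _ => ?_
    have : (Pi.single b 1 : Fin (R.rank 0) → MvPolynomial V K) = fun j => if b = j then 1 else 0 := by
      ext1 c
      simp [Pi.single_apply, eq_comm]
    rw [this]
    rfl
  obtain ⟨r, hr⟩ := R.aug_surjective (Ideal.Quotient.mk I m)
  refine ⟨trunc (R.deg 0) j r, isHomogeneousElt_trunc _ _ _, ?_⟩
  rw [haug, Ideal.Quotient.eq] at hr
  have h2 := hI _ hr j
  rw [map_sub, homogeneousComponent_of_mem hm, if_pos rfl] at h2
  rw [haug, hΦ.trunc, trunc_zero_apply, Ideal.Quotient.eq]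
  exact h2

end Lifting

/-! ### The incidence cocycle and the nonzero homology class. -/

section Functional

variable {V K : Type*} [DecidableEq V] [Field K] {s : ℕ}

/-- The incidence determinant of a tuple and a family of finite sets. -/
noncomputable def incidenceDet (K : Type*) [Field K] (G : Fin s → Finset V) (t : Fin s → V) : K :=
  (Matrix.of fun a b => if t a ∈ G b then (1 : K) else 0).det

lemma incidenceDet_eq_zero_of_notMem {G : Fin s → Finset V} {t : Fin s → V} (a : Fin s)
    (h : ∀ b, t a ∉ G b) : incidenceDet K G t = 0 :=
  Matrix.det_eq_zero_of_row_eq_zero a fun b => by simp [h b]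

lemma incidenceDet_eq_zero_of_disjoint {G : Fin s → Finset V} {t : Fin s → V} (b : Fin s)
    (h : ∀ a, t a ∉ G b) : incidenceDet K G t = 0 :=
  Matrix.det_eq_zero_of_column_eq_zero b fun a => by simp [h a]

/-- This is the Laplace expansion, along a column of ones, of the incidence matrix bordered by that
column. Each point lies in exactly one block, so the column of ones is the sum of the others. -/
lemma sum_incidenceDet_removeNth {G : Fin s → Finset V} {t : Fin (s + 1) → V}
    (h : ∀ a, ∃! b, t a ∈ G b) :
    ∑ i : Fin (s + 1), (-1 : K) ^ (i : ℕ) * incidenceDet K G (i.removeNth t) = 0 := by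
  let A : Matrix (Fin (s + 1)) (Fin (s + 1)) K :=
    Matrix.of fun a => Fin.cons 1 fun b => if t a ∈ G b then 1 else 0
  have h0 : A.det = 0 := by
    refine Matrix.exists_mulVec_eq_zero_iff.1 ⟨Fin.cons 1 fun _ => -1, ?_, ?_⟩
    · intro h
      simpa using congrFun h 0
    · ext a
      obtain ⟨b, hb, hb'⟩ := h a
      have h2 (c : Fin s) : t a ∈ G c ↔ b = c := ⟨fun hc => (hb' c hc).symm, fun e => e ▸ hb⟩
      simp [A, Matrix.mulVec, dotProduct, Fin.sum_univ_succ, h2]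
  rw [Matrix.det_succ_column_zero] at h0
  rw [← h0]
  refine Finset.sum_congr rfl fun i _ => ?_
  have h3 : A i 0 = 1 := by simp [A]
  rw [h3, mul_one]
  rfl

/-- The functional on `s`-chains in multidegree `U` given by the incidence determinants. -/
noncomputable def incidenceFunctional (K : Type*) [Field K] (U : Finset V) (G : Fin s → Finset V) :
    ((Fin s → V) →₀ MvPolynomial V K) →ₗ[K] K :=
  Finsupp.lsum K fun t => incidenceDet K G t • lcoeff K (sqfree (U \ pts t))

lemma incidenceFunctional_single (U : Finset V) (G : Fin s → Finset V) (t : Fin s → V)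
    (m : MvPolynomial V K) : incidenceFunctional K U G (Finsupp.single t m) =
      incidenceDet K G t * coeff (sqfree (U \ pts t)) m := by
  simp [incidenceFunctional]

lemma incidenceFunctional_bdry {U : Finset V} {G : Fin s → Finset V}
    (hG : ∀ u, u ∈ U → ∃! b, u ∈ G b) (hGU : ∀ b, G b ⊆ U)
    (x : (Fin (s + 1) → V) →₀ MvPolynomial V K) :
    incidenceFunctional K U G (bdry K _ s x) = 0 := by
  induction x using Finsupp.induction_linear with
  | zero => simp
  | add x y hx hy => simp only [map_add, hx, hy, add_zero]
  | single t m =>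
    simp only [bdry_single, map_sum, incidenceFunctional_single, smul_eq_mul]
    by_cases ht : pts t ⊆ U
    · have h1 (i : Fin (s + 1)) : sqfree (U \ pts (i.removeNth t)) =
          (sqfree (pts t) - sqfree (pts (i.removeNth t))) + sqfree (U \ pts t) := by
        ext u
        have h2 := @pts_removeNth_subset _ _ _ t i u
        have h3 := @ht u
        simp only [Finsupp.add_apply, Finsupp.tsub_apply, sqfree_apply, mem_sdiff]
        by_cases hu1 : u ∈ pts t <;> by_cases hu2 : u ∈ pts (i.removeNth t) <;>
          by_cases hu3 : u ∈ U <;> simp_all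
      have h4 := sum_incidenceDet_removeNth (K := K) (G := G) (t := t)
        fun a => hG _ (ht (mem_pts.2 ⟨a, rfl⟩))
      rw [← zero_mul (coeff (sqfree (U \ pts t)) m), ← h4, Finset.sum_mul]
      refine Finset.sum_congr rfl fun i _ => ?_
      rw [h1, coeff_monomial_mul]
      ring
    -- For a point `u` of `t` outside `U`, a face keeping `u` has a zero row, and a face losing
    -- every `u` acquires a factor `x_u`, absent from multidegree `U`.
    · obtain ⟨u, hut, huU⟩ := Finset.not_subset.1 ht
      refine Finset.sum_eq_zero fun i _ => ?_
      by_cases hi : u ∈ pts (i.removeNth t)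
      · obtain ⟨a, ha⟩ := mem_pts.1 hi
        rw [incidenceDet_eq_zero_of_notMem a fun b hb => huU (ha ▸ hGU b hb), zero_mul]
      · rw [coeff_monomial_mul', if_neg, mul_zero]
        intro hle
        have := hle u
        simp [sqfree_apply, hut, hi, huU] at this

variable [Fintype V]

/-- Over a squarefree monomial ideal, the incidence functional detects a nonzero homology class. -/
theorem exists_generator_of_incidence {𝓗 : Set (Finset V)} {I : Ideal (MvPolynomial V K)}
    (hI : ∀ f : MvPolynomial V K, f ∈ I ↔ ∀ u ∈ f.support, ∃ H ∈ 𝓗, H ⊆ u.support)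
    (R : MinimalGradedFreeResolution I) {F G : Fin s → Finset V} {U : Finset V} {v : Fin s → V}
    (hF : ∀ i, F i ∈ 𝓗) (hFU : ∀ i, F i ⊆ U) (hGF : ∀ i, G i ⊆ F i)
    (hG : ∀ u, u ∈ U → ∃! b, u ∈ G b) (hcov : ∀ H ∈ 𝓗, H ⊆ U → ∃ i, G i ⊆ H)
    (hv : ∀ i j, v i ∈ F j ↔ i = j) : ∃ b, R.deg s b = U.card := by
  have hvU : pts v ⊆ U := by
    intro u hu
    obtain ⟨i, rfl⟩ := mem_pts.1 hu
    exact hFU i ((hv i i).2 rfl)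
  have hI' : ∀ f ∈ I, ∀ j, homogeneousComponent j f ∈ I := by
    intro f hf j
    rw [hI] at hf ⊢
    intro u hu
    refine hf u ?_
    rw [mem_support_iff, coeff_homogeneousComponent] at hu
    rw [mem_support_iff]
    intro h
    exact hu (by simp [h])
  let m : MvPolynomial V K := monomial (sqfree (U \ pts v)) 1
  have hm : m.IsHomogeneous (U \ pts v).card :=
    isHomogeneous_monomial _ (degree_sqfree _)
  obtain ⟨r, hr, hrm⟩ := exists_homogeneous_aug_eq R hI' hm
  let z₀ : (Fin s → V) →₀ (Fin (R.rank 0) → MvPolynomial V K) := Finsupp.single v r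
  have haug : chainMap s R.aug z₀ = chainMap s I.mkQ (Finsupp.single v m) := by
    simp only [z₀, chainMap, Finsupp.mapRange.linearMap_apply, Finsupp.mapRange_single, hrm]
    rfl
  refine exists_generator_of_cycle R (z := z₀) ?_ ?_ ?_
  · intro t
    by_cases ht : t = v
    · subst ht
      intro b u hu
      rw [Finsupp.single_eq_same] at hu
      have := hr b u hu
      have := card_sdiff_add_card_eq_card hvU
      simp only
      omega
    · rw [Finsupp.single_eq_of_ne ht]
      exact IsHomogeneousElt.zero _ _
  · rw [haug]
    clear_value z₀
    cases s with
    | zero => trivial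
    | succ p =>
      change bdry K _ p _ = 0
      rw [bdry_chainMap, bdry_single, map_sum]
      refine Finset.sum_eq_zero fun i _ => ?_
      simp only [chainMap, Finsupp.mapRange.linearMap_apply, Finsupp.mapRange_single]
      rw [Finsupp.single_eq_zero, Submodule.mkQ_apply, Submodule.Quotient.mk_eq_zero, hI]
      intro u hu
      rw [smul_eq_mul, monomial_mul] at hu
      obtain rfl := Finset.mem_singleton.1 (support_monomial_subset hu)
      -- The monomial is now supported on `U` minus the other private vertices, none of which lies
      -- in `F i`.
      refine ⟨F i, hF i, fun w hw => ?_⟩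
      rw [Finsupp.mem_support_iff, Finsupp.add_apply, Finsupp.tsub_apply, sqfree_apply,
        sqfree_apply, sqfree_apply]
      by_cases hwv : w ∈ pts v
      · have : w ∉ pts (i.removeNth v) := by
          intro h
          obtain ⟨j, rfl⟩ := mem_pts.1 h
          exact Fin.succAbove_ne i j ((hv _ _).1 hw)
        simp [hwv, this]
      · simp [hwv, hFU i hw]
  · rintro ⟨y, hy⟩
    -- Lifting to polynomial chains, the representative differs from a boundary by a chain with
    -- coefficients in `I`, on which the functional must vanish.
    obtain ⟨x, hx⟩ := Finsupp.mapRange_surjective _ (map_zero I.mkQ) I.mkQ_surjective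
      (chainMap (s + 1) R.aug y)
    have hx' : chainMap (s + 1) I.mkQ x = chainMap (s + 1) R.aug y := hx
    rw [haug, ← hx', bdry_chainMap, ← sub_eq_zero, ← map_sub] at hy
    have h1 (q : (Fin s → V) →₀ MvPolynomial V K) (hq : ∀ t, q t ∈ I) :
        incidenceFunctional K U G q = 0 := by
      rw [← Finsupp.sum_single q, Finsupp.sum, map_sum]
      refine Finset.sum_eq_zero fun t _ => ?_
      rw [incidenceFunctional_single]
      by_cases hc : coeff (sqfree (U \ pts t)) (q t) = 0
      · rw [hc, mul_zero]
      · obtain ⟨H, hH, hHs⟩ := (hI _).1 (hq t) _ (mem_support_iff.2 hc)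
        rw [support_sqfree] at hHs
        obtain ⟨b, hb⟩ := hcov H hH (hHs.trans sdiff_subset)
        rw [incidenceDet_eq_zero_of_disjoint b, zero_mul]
        intro a ha
        exact (mem_sdiff.1 (hHs (hb ha))).2 (mem_pts.2 ⟨a, rfl⟩)
    have h2 := h1 _ fun t => (Submodule.Quotient.mk_eq_zero I).1 (DFunLike.congr_fun hy t)
    rw [map_sub, incidenceFunctional_bdry hG fun b => (hGF b).trans (hFU b), sub_zero,
      incidenceFunctional_single] at h2
    have h3 : incidenceDet K G v = 1 := by
      suffices h : (Matrix.of fun a b => if v a ∈ G b then (1 : K) else 0) = 1 by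
        rw [incidenceDet, h, Matrix.det_one]
      ext a b
      rw [Matrix.of_apply, Matrix.one_apply]
      refine if_congr ⟨fun h => (hv a b).1 (hGF b h), ?_⟩ rfl rfl
      rintro rfl
      obtain ⟨c, hc, -⟩ := hG (v a) (hvU (mem_pts.2 ⟨a, rfl⟩))
      obtain rfl := (hv a c).1 (hGF c hc)
      exact hc
    simp [h3, m] at h2

end Functional

end FacetIdeal

/-! ### Facets, facet ideals and well ordered covers. -/

namespace PreAbstractSimplicialComplex

variable {V : Type*}

lemma nonempty_of_mem_facets {Γ : PreAbstractSimplicialComplex V} {F : Finset V}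
    (hF : F ∈ Γ.facets) : F.Nonempty :=
  (Γ.isRelLowerSet_faces hF.prop).1

lemma mem_facets_inducedSubcollection {Γ : PreAbstractSimplicialComplex V} {A F : Finset V} :
    F ∈ (Γ.inducedSubcollection A).facets ↔ F ∈ Γ.facets ∧ F ⊆ A := by
  constructor
  · rintro ⟨⟨-, G, hG, hGA, hFG⟩, hmax⟩
    have := hmax (y := G) ⟨nonempty_of_mem_facets hG, G, hG, hGA, subset_rfl⟩ hFG
    obtain rfl := subset_antisymm hFG this
    exact ⟨hG, hGA⟩
  · rintro ⟨hF, hFA⟩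
    refine ⟨⟨nonempty_of_mem_facets hF, F, hF, hFA, subset_rfl⟩, ?_⟩
    rintro G ⟨-, H, hH, -, hGH⟩ hFG
    exact hGH.trans (hF.2 hH.prop (hFG.trans hGH))

lemma mem_vertices_of_mem_facet {Γ : PreAbstractSimplicialComplex V} {F : Finset V} {v : V}
    (hF : F ∈ Γ.facets) (hv : v ∈ F) : v ∈ Γ.vertices :=
  (Γ.isRelLowerSet_faces hF.prop).2 (Finset.singleton_subset_iff.2 hv)
    (Finset.singleton_nonempty v)

lemma mem_facetIdeal_iff {K : Type*} [Field K] {Γ : PreAbstractSimplicialComplex V}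
    (f : MvPolynomial V K) :
    f ∈ Γ.facetIdeal K ↔ ∀ u ∈ f.support, ∃ H ∈ Γ.facets, H ⊆ u.support := by
  classical
  have : {m : MvPolynomial V K | ∃ F ∈ Γ.facets, m = ∏ v ∈ F, MvPolynomial.X v} =
      (fun u => MvPolynomial.monomial u 1) '' (FacetIdeal.sqfree '' Γ.facets) := by
    rw [Set.image_image]
    ext m
    simp only [Set.mem_image, FacetIdeal.monomial_sqfree, Set.mem_ofPred_eq, eq_comm]
  rw [facetIdeal, this, MvPolynomial.mem_ideal_span_monomial_image]
  simp only [Set.exists_mem_image, FacetIdeal.sqfree_le_iff]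

lemma nonempty_resolution_facetIdeal [Finite V] (K : Type*) [Field K]
    (Γ : PreAbstractSimplicialComplex V) :
    Nonempty (MinimalGradedFreeResolution (Γ.facetIdeal K)) := by
  refine FacetIdeal.nonempty_minimalGradedFreeResolution ?_ ?_
  · intro f hf j
    rw [mem_facetIdeal_iff] at hf ⊢
    intro u hu
    refine hf u ?_
    rw [MvPolynomial.mem_support_iff, MvPolynomial.coeff_homogeneousComponent] at hu
    rw [MvPolynomial.mem_support_iff]
    intro h
    exact hu (by simp [h])
  · intro f hf
    by_contra h
    obtain ⟨H, hH, hs⟩ := (mem_facetIdeal_iff f).1 hf 0 (MvPolynomial.mem_support_iff.2 h)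
    obtain ⟨v, hv⟩ := nonempty_of_mem_facets hH
    simpa using hs hv

variable [DecidableEq V]

omit [DecidableEq V] in
/-- In a minimal facet cover every facet has a vertex of its own. -/
lemma exists_private_vertex {Γ : PreAbstractSimplicialComplex V} {s : ℕ} {F : Fin s → Finset V}
    (hinj : Function.Injective F) (hF : Γ.IsMinimalFacetCover (Set.range F)) (i : Fin s) :
    ∃ v, ∀ j, v ∈ F j ↔ i = j := by
  have h : ¬Γ.IsFacetCover (Set.range F \ {F i}) := fun hc =>
    (hF.2 hc Set.sdiff_subset (Set.mem_range_self i)).2 rfl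
  simp only [IsFacetCover, not_and, not_forall, not_exists] at h
  obtain ⟨v, hv, hn⟩ := h (Set.sdiff_subset.trans hF.prop.1)
  have hj (j : Fin s) (hvj : v ∈ F j) : i = j := by
    by_contra hij
    exact hn _ ⟨Set.mem_range_self j, fun e => hij (hinj e).symm⟩ hvj
  obtain ⟨_, ⟨k, rfl⟩, hk⟩ := hF.prop.2 v hv
  refine ⟨v, fun j => ⟨hj j, ?_⟩⟩
  rintro rfl
  rwa [hj k hk]

/-- The block containing `u` is indexed by the last `b` with `u ∈ F b`. -/
lemma existsUnique_mem_sdiff_biUnion_Ioi {s : ℕ} (F : Fin s → Finset V) {u : V}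
    (hu : u ∈ Finset.univ.biUnion F) : ∃! b, u ∈ F b \ (Finset.Ioi b).biUnion F := by
  have hne : (Finset.univ.filter fun b => u ∈ F b).Nonempty := by
    obtain ⟨b, -, hb⟩ := Finset.mem_biUnion.1 hu
    exact ⟨b, by simpa using hb⟩
  obtain ⟨c, hmem, hle⟩ : ∃ c, u ∈ F c ∧ ∀ d, u ∈ F d → d ≤ c :=
    ⟨_, (Finset.mem_filter.1 (Finset.max'_mem _ hne)).2,
      fun d hd => Finset.le_max' _ _ (by simpa using hd)⟩
  refine ⟨c, ?_, ?_⟩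
  · simp only [Finset.mem_sdiff, Finset.mem_biUnion, Finset.mem_Ioi, not_exists, not_and]
    exact ⟨hmem, fun d hd hud => absurd (hle d hud) (not_le.2 hd)⟩
  · intro b hb
    simp only [Finset.mem_sdiff, Finset.mem_biUnion, Finset.mem_Ioi, not_exists, not_and] at hb
    by_contra hbc
    exact hb.2 c (lt_of_le_of_ne (hle b hb.1) hbc) hmem

/-- A well ordered facet cover of an induced subcollection gives a generator of degree the number
of covered vertices in every minimal graded free resolution. -/
lemma IsWellOrderedFacetCover.exists_generator [Fintype V] {K : Type*} [Field K]
    {Γ : PreAbstractSimplicialComplex V} {A : Finset V} {s : ℕ} {F : Fin s → Finset V}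
    (h : (Γ.inducedSubcollection A).IsWellOrderedFacetCover F)
    (R : MinimalGradedFreeResolution (Γ.facetIdeal K)) :
    ∃ b, R.deg s b = (Finset.univ.biUnion F).card := by
  obtain ⟨hinj, hmin, hord⟩ := h
  have hF (i : Fin s) := mem_facets_inducedSubcollection.1 (hmin.prop.1 (Set.mem_range_self i))
  choose v hv using exists_private_vertex hinj hmin
  refine FacetIdeal.exists_generator_of_incidence mem_facetIdeal_iff R (fun i => (hF i).1)
    (fun i => Finset.subset_biUnion_of_mem F (Finset.mem_univ i)) (fun i => Finset.sdiff_subset)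
    (fun u hu => existsUnique_mem_sdiff_biUnion_Ioi F hu) ?_ hv
  intro H hH hHU
  by_cases hr : H ∈ Set.range F
  · obtain ⟨i, rfl⟩ := hr
    exact ⟨i, Finset.sdiff_subset⟩
  · have hHA : H ⊆ A := hHU.trans (Finset.biUnion_subset.2 fun i _ => (hF i).2)
    obtain ⟨i, -, hi⟩ := hord H (mem_facets_inducedSubcollection.2 ⟨hH, hHA⟩) hr
    -- The well ordering condition says precisely that `H` contains the part of `F i` not covered by
    -- later facets.
    refine ⟨i, fun u hu => ?_⟩
    obtain ⟨hui, hun⟩ := Finset.mem_sdiff.1 hu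
    exact (Finset.mem_union.1 (hi hui)).resolve_right hun

lemma IsInducedMatching.isWellOrderedFacetCover {Γ : PreAbstractSimplicialComplex V} {s : ℕ}
    {F : Fin s → Finset V} (h : Γ.IsInducedMatching F) :
    (Γ.inducedSubcollection (Finset.univ.biUnion F)).IsWellOrderedFacetCover F := by
  obtain ⟨hF, hdisj, hfacets⟩ := h
  have hmem (i : Fin s) : F i ∈ (Γ.inducedSubcollection (Finset.univ.biUnion F)).facets := by
    rw [hfacets]
    exact Set.mem_range_self i
  refine ⟨fun i j hij => ?_, ⟨⟨hfacets.symm.subset, ?_⟩, ?_⟩, ?_⟩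
  · by_contra hne
    have := hdisj i j hne
    rw [← hij, disjoint_self] at this
    exact (nonempty_of_mem_facets (hF i)).ne_empty this
  · rintro v ⟨-, G, -, hGU, hvG⟩
    obtain ⟨i, -, hi⟩ := Finset.mem_biUnion.1 (hGU (Finset.singleton_subset_iff.1 hvG))
    exact ⟨F i, Set.mem_range_self i, hi⟩
  · rintro D hD hDF _ ⟨i, rfl⟩
    obtain ⟨v, hv⟩ := nonempty_of_mem_facets (hF i)
    obtain ⟨G, hGD, hvG⟩ := hD.2 v (mem_vertices_of_mem_facet (hmem i) hv)
    obtain ⟨j, rfl⟩ := hDF hGD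
    obtain rfl : i = j := by
      by_contra hij
      exact Finset.disjoint_left.1 (hdisj i j hij) hv hvG
    exact hGD
  · intro H hH hr
    exact absurd (hfacets ▸ hH) hr

end PreAbstractSimplicialComplex

theorem mainTheorem4 {V : Type*} [Fintype V] [DecidableEq V] (K : Type*) [Field K]
    (Γ : AbstractSimplicialComplex V) :
    (∀ (A : Finset V) (s : ℕ) (F : Fin s → Finset V),
      (Γ.inducedSubcollection A).IsWellOrderedFacetCover F →
        ((((Finset.univ.biUnion F).card : ℝ) - (s : ℝ) : ℝ) : EReal) ≤
          quotientRegularity (Γ.facetIdeal K)) ∧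
    (∀ (s : ℕ) (F : Fin s → Finset V), Γ.IsInducedMatching F →
      (Γ.inducedSubcollection (Finset.univ.biUnion F)).IsWellOrderedFacetCover F) := by
  refine ⟨fun A s F hF => ?_, fun s F hF => hF.isWellOrderedFacetCover⟩
  refine le_sSup ⟨s, (Finset.univ.biUnion F).card, ?_, rfl⟩
  -- Without a resolution `gradedBetti` would take its default value `0`, so existence has to be
  -- proved.
  have hres := Γ.nonempty_resolution_facetIdeal K
  rw [gradedBetti, dif_pos hres]
  obtain ⟨b, hb⟩ := hF.exists_generator hres.some
  exact Nat.card_ne_zero.2 ⟨⟨⟨b, hb⟩⟩, inferInstance⟩
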